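/- **Theorem (CLT on the $p$-adic solenoid).** Let $p$ be a prime, let $\mathbb{T}=\{z\in\mathbb{C}:|z|=1\}$, and let $$S_p=\{(y_0,y_1,\dots)\in\mathbb{T}^{\infty}: y_j=y_{j+1}^p \text{ for all } j\ge 0\}$$ be the $p$-adic solenoid, a compact Abelian group under componentwise multiplication with the topology of $\mathbb{T}^\infty$; its group operation is written additively below and its identity is denoted by $e$. Its characters are $\chi_{d,\ell}(y)=y_d^\ell$, $d\in\mathbb{Z}_+=\{0,1,2,\dots\}$, $\ell\in\mathbb{Z}$. For $b\ge 0$ let $\psi_b(\chi_{d,\ell})=b\ell^2/p^{2d}$, and let $\gamma_{\psi_b}$ be the unique Borel probability measure on $S_p$ with Fourier transform $\int_{S_p}\chi\,d\gamma_{\psi_b}=e^{-\psi_b(\chi)/2}$ for every character $\chi$ of $S_p$ (a symmetric Gauss measure). Let $\arg:\mathbb{T}\to[-\pi,\pi)$ be given by $\arg(e^{ix})=x$ for $-\pi\le x<\pi$. Let $\{X_{n,k}:n\in\mathbb{N},\ k=1,\dots,K_n\}$ be a rowwise independent array of random elements of $S_p$. Suppose that there exist $a=(a_0,a_1,\dots)\in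 S_p$ and $b\ge 0$ such that, as $n\to\infty$, 1. $\exp\Big\{\dfrac{i}{p^d}\sum_{k=1}^{K_n}\mathrm{E}\arg\big((X_{n,k})_0\big)\Big\}\to a_d$ for all $d\in\mathbb{Z}_+$; 2. $\sum_{k=1}^{K_n}\mathrm{Var}\arg\big((X_{n,k})_0\big)\to b$; 3. $\sum_{k=1}^{K_n}\mathrm{P}\big(\exists\, j\le d:\ |\arg((X_{n,k})_j)|>\varepsilon\big)\to 0$ for all $d\in\mathbb{Z}_+$ and all $\varepsilon>0$. Then the array is infinitesimal, i.e. $\max_{1\le k\le K_n}\mathrm{P}(X_{n,k}\in S_p\setminus U)\to 0$ as $n\to\infty$ for every Borel neighbourhood $U$ of $e$, and the row sums $\sum_{k=1}^{K_n}X_{n,k}$ converge in distribution to $\delta_a*\gamma_{\psi_b}$ as $n\to\infty$. -/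

import Mathlib

open Filter Topology MeasureTheory ProbabilityTheory
open scoped NNReal

noncomputable section

/-- The `p`-adic solenoid `S_p`: the sequences `(y₀, y₁, …)` in the infinite torus such that
`y_j = y_{j+1} ^ p` for all `j`. It is written multiplicatively (componentwise multiplication)
and has the topology induced by the product topology. -/
def solenoid (p : ℕ) : Subgroup (ℕ → Circle) where
  carrier := {y | ∀ j, y j = y (j + 1) ^ p}
  one_mem' := by intro j; simp
  mul_mem' := by
    intro x y hx hy j
    simp only [Pi.mul_apply, mul_pow, hx j, hy j]
  inv_mem' := by
    intro x hx j
    simp only [Pi.inv_apply, inv_pow, hx j]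

namespace solenoid

variable {p : ℕ}

/-- `S_p` carries its Borel `σ`-algebra. -/
instance : MeasurableSpace (solenoid p) := borel _

instance : BorelSpace (solenoid p) := ⟨rfl⟩

theorem isClosed_carrier : IsClosed (solenoid p : Set (ℕ → Circle)) := by
  have : (solenoid p : Set (ℕ → Circle)) = ⋂ j : ℕ, {y | y j = y (j + 1) ^ p} := by
    ext y; simp [solenoid]
  rw [this]
  exact isClosed_iInter fun j => isClosed_eq (by fun_prop) (by fun_prop)

instance : CompactSpace (solenoid p) :=
  isCompact_iff_compactSpace.mp isClosed_carrier.isCompact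

instance : SecondCountableTopology (solenoid p) :=
  inferInstanceAs (SecondCountableTopology (solenoid p : Set (ℕ → Circle)))

theorem coord_eq_pow (y : solenoid p) (d e : ℕ) : y.1 d = y.1 (d + e) ^ p ^ e := by
  induction e with
  | zero => simp
  | succ e ih => rw [ih, y.2 (d + e), ← pow_mul, pow_succ', add_assoc]

/-- The character `χ_{d,ℓ}(y) = y_d ^ ℓ` of `S_p`. -/
def char (p d : ℕ) (l : ℤ) : PontryaginDual (solenoid p) :=
  ContinuousMonoidHom.mk
    (MonoidHom.mk' (fun y : solenoid p => y.1 d ^ l) fun x y => by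
      simp [mul_zpow])
    (by
      show Continuous fun y : solenoid p => y.1 d ^ l
      exact ((continuous_apply d).comp continuous_subtype_val).zpow l)

@[simp]
theorem char_apply (d : ℕ) (l : ℤ) (y : solenoid p) : char p d l y = y.1 d ^ l := rfl

theorem char_eq_char_add (d e : ℕ) (l : ℤ) :
    char p d l = char p (d + e) (p ^ e * l) := by
  ext y
  rw [char_apply, char_apply, coord_eq_pow y d e, zpow_mul]
  norm_cast

theorem exists_char_mul (d d' : ℕ) (l l' : ℤ) :
    ∃ (m : ℕ) (k : ℤ), char p d l * char p d' l' = char p m k := by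
  refine ⟨d + d', p ^ d' * l + p ^ d * l', ?_⟩
  rw [char_eq_char_add d d' l, char_eq_char_add d' d l', add_comm d' d]
  refine PontryaginDual.ext fun y => ?_
  exact (zpow_add (y.1 (d + d')) _ _).symm

/-- The one-parameter subgroup `t ↦ (e^{it/p^j})_j` of `S_p`. -/
def flow (p : ℕ) [hp : Fact p.Prime] (t : ℝ) : solenoid p :=
  ⟨fun j => Circle.exp (t / p ^ j), fun j => by
    have : (p : ℝ) ≠ 0 := by exact_mod_cast hp.out.ne_zero
    rw [← Circle.exp_nsmul, nsmul_eq_mul]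
    rw [pow_succ]
    field_simp⟩

theorem continuous_flow [Fact p.Prime] : Continuous (flow p) := by
  refine Continuous.subtype_mk ?_ _
  exact continuous_pi fun j => Circle.exp.continuous.comp (by fun_prop)

theorem char_flow [Fact p.Prime] (d : ℕ) (l : ℤ) (t : ℝ) :
    char p d l (flow p t) = Circle.exp ((l / p ^ d) * t) := by
  rw [char_apply]
  show Circle.exp (t / p ^ d) ^ l = _
  rw [← Circle.exp_zsmul, zsmul_eq_mul]
  congr 1
  ring

/-- The number `ℓ / p^d` is determined by the character `χ_{d,ℓ}`. -/
theorem freq_unique [Fact p.Prime] {d d' : ℕ} {l l' : ℤ} (h : char p d l = char p d' l') :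
    (l / p ^ d : ℝ) = l' / p ^ d' := by
  by_contra hne
  set s : ℝ := l / p ^ d - l' / p ^ d' with hs
  have hs0 : s ≠ 0 := sub_ne_zero.mpr hne
  have h1 := char_flow (p := p) d l (Real.pi / s)
  rw [h, char_flow] at h1
  have h2 : Circle.exp (s * (Real.pi / s)) = 1 := by
    rw [hs, sub_mul, Circle.exp_sub, ← hs, h1, div_self']
  rw [mul_div_cancel₀ _ hs0, Circle.exp_eq_one] at h2
  obtain ⟨n, hn⟩ := h2
  have h3 : (1 : ℝ) = n * 2 := by
    have := Real.pi_ne_zero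
    field_simp at hn
    linarith
  have h4 : (1 : ℤ) = n * 2 := by exact_mod_cast h3
  omega

/-- A character as a continuous complex-valued function. -/
def toC (χ : PontryaginDual (solenoid p)) : C(solenoid p, ℂ) :=
  ⟨fun y => (χ y : ℂ), continuous_subtype_val.comp (map_continuous χ)⟩

theorem toC_apply (χ : PontryaginDual (solenoid p)) (y : solenoid p) : toC χ y = (χ y : ℂ) := rfl

/-- Trigonometric polynomials built from the characters `χ_{d,ℓ}` are uniformly dense. -/
theorem exists_span_near (f : C(solenoid p, ℂ)) {ε : ℝ} (hε : 0 < ε) :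
    ∃ g ∈ Submodule.span ℂ (Set.range fun q : ℕ × ℤ => toC (char p q.1 q.2)),
      ∀ y, ‖f y - g y‖ < ε := by
  set R : Set C(solenoid p, ℂ) := Set.range fun q : ℕ × ℤ => toC (char p q.1 q.2) with hR
  let A : StarSubalgebra ℂ C(solenoid p, ℂ) :=
    { toSubalgebra := Algebra.adjoin ℂ R
      star_mem' := by
        change Algebra.adjoin ℂ R ≤ star (Algebra.adjoin ℂ R)
        refine Algebra.adjoin_le ?_
        rintro - ⟨⟨d, l⟩, rfl⟩
        refine Algebra.subset_adjoin ⟨(d, -l), ?_⟩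
        ext y
        simp [toC_apply, ← Circle.coe_inv_eq_conj] }
  have hspan : Subalgebra.toSubmodule (Algebra.adjoin ℂ R) = Submodule.span ℂ R := by
    apply Algebra.adjoin_eq_span_of_subset
    refine Set.Subset.trans ?_ Submodule.subset_span
    intro x hx
    refine Submonoid.closure_induction (fun _ => id) ⟨(0, 0), ?_⟩ ?_ hx
    · ext y; simp [toC_apply]
    · rintro - - - - ⟨⟨d, l⟩, rfl⟩ ⟨⟨d', l'⟩, rfl⟩
      obtain ⟨m, k, h⟩ := exists_char_mul (p := p) d d' l l'
      refine ⟨(m, k), ?_⟩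
      ext y
      show ((char p m k) y : ℂ) = (char p d l y : ℂ) * (char p d' l' y : ℂ)
      rw [← h, ← Circle.coe_mul]
      rfl
  have hsep : A.SeparatesPoints := by
    intro x y hxy
    obtain ⟨d, hd⟩ : ∃ d, x.1 d ≠ y.1 d := by
      by_contra! h
      exact hxy (Subtype.ext (funext h))
    refine ⟨_, ⟨toC (char p d 1), Algebra.subset_adjoin ⟨(d, 1), rfl⟩, rfl⟩, ?_⟩
    simpa [toC_apply, Circle.ext_iff] using hd
  have htop := ContinuousMap.starSubalgebra_topologicalClosure_eq_top_of_separatesPoints A hsep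
  have hf : f ∈ A.topologicalClosure := by rw [htop]; trivial
  have hf' : f ∈ closure (A : Set C(solenoid p, ℂ)) := hf
  obtain ⟨g, hg, hfg⟩ := Metric.mem_closure_iff.mp hf' ε hε
  refine ⟨g, ?_, fun y => ?_⟩
  · rw [← hspan]; exact hg
  · rw [dist_eq_norm] at hfg
    exact ((f - g).norm_coe_le_norm y).trans_lt hfg

theorem integrable_C (μ : Measure (solenoid p)) [IsFiniteMeasure μ] (f : C(solenoid p, ℂ)) :
    Integrable (fun y => f y) μ :=
  Integrable.of_bound f.continuous.aestronglyMeasurable ‖f‖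
    (ae_of_all _ fun y => f.norm_coe_le_norm y)

/-- A probability measure on `S_p` is determined by its Fourier transform. -/
theorem measure_ext (μ ν : Measure (solenoid p)) [IsProbabilityMeasure μ] [IsProbabilityMeasure ν]
    (h : ∀ d l, ∫ y, (char p d l y : ℂ) ∂μ = ∫ y, (char p d l y : ℂ) ∂ν) : μ = ν := by
  have hs : ∀ g ∈ Submodule.span ℂ (Set.range fun q : ℕ × ℤ => toC (char p q.1 q.2)),
      ∫ y, g y ∂μ = ∫ y, g y ∂ν := by
    intro g hg
    induction hg using Submodule.span_induction with
    | mem x hx => obtain ⟨⟨d, l⟩, rfl⟩ := hx; exact h d l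
    | zero => simp
    | add x y _ _ hx hy =>
      simp only [ContinuousMap.add_apply]
      rw [integral_add (integrable_C μ x) (integrable_C μ y),
        integral_add (integrable_C ν x) (integrable_C ν y), hx, hy]
    | smul c x _ hx =>
      simp only [ContinuousMap.smul_apply, integral_smul, hx]
  have hC : ∀ f : C(solenoid p, ℂ), ∫ y, f y ∂μ = ∫ y, f y ∂ν := by
    intro f
    by_contra hne
    have hpos : 0 < ‖∫ y, f y ∂μ - ∫ y, f y ∂ν‖ := norm_pos_iff.mpr (sub_ne_zero.mpr hne)
    obtain ⟨g, hg, hfg⟩ := exists_span_near f (half_pos (half_pos hpos))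
    set ε := ‖∫ y, f y ∂μ - ∫ y, f y ∂ν‖
    have key : ∀ (κ : Measure (solenoid p)) [IsProbabilityMeasure κ],
        ‖∫ y, f y ∂κ - ∫ y, g y ∂κ‖ ≤ ε / 2 / 2 := by
      intro κ _
      rw [← integral_sub (integrable_C κ f) (integrable_C κ g)]
      refine (norm_integral_le_of_norm_le_const (ae_of_all _ fun y => (hfg y).le)).trans ?_
      simp
    have h1 := key μ
    have h2 := key ν
    have h3 : ε ≤ ε / 2 / 2 + ε / 2 / 2 := by
      calc ε = ‖(∫ y, f y ∂μ - ∫ y, g y ∂μ) - (∫ y, f y ∂ν - ∫ y, g y ∂ν)‖ := by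
            rw [hs g hg]; simp only [sub_sub_sub_cancel_right]; rfl
        _ ≤ _ := (norm_sub_le _ _).trans (add_le_add h1 h2)
    linarith
  refine ext_of_forall_integral_eq_of_IsFiniteMeasure fun f => ?_
  have h1 := hC ⟨fun y => ((f y : ℝ) : ℂ), by fun_prop⟩
  simp only [ContinuousMap.coe_mk] at h1
  rw [integral_complex_ofReal, integral_complex_ofReal] at h1
  exact_mod_cast h1

/-- Every character of `S_p` is one of the `χ_{d,ℓ}`. -/
theorem exists_eq_char (χ : PontryaginDual (solenoid p)) : ∃ d l, χ = char p d l := by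
  by_contra! hne
  let K : TopologicalSpace.PositiveCompacts (solenoid p) := ⊤
  let μ : Measure (solenoid p) := Measure.haarMeasure K
  have : IsProbabilityMeasure μ := ⟨by
    have := Measure.haarMeasure_self (K₀ := K)
    simpa [K] using this⟩
  have hzero : ∀ d l, ∫ y, ((χ⁻¹ y : Circle) : ℂ) * (char p d l y : ℂ) ∂μ = 0 := by
    intro d l
    obtain ⟨x, hx⟩ : ∃ x, χ x ≠ char p d l x := by
      by_contra! h
      exact hne d l (PontryaginDual.ext h)
    set F : solenoid p → ℂ := fun y => ((χ⁻¹ y : Circle) : ℂ) * (char p d l y : ℂ) with hF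
    have hmul : ∀ y, F (x * y) = F x * F y := by
      intro y
      simp only [hF, map_mul, Circle.coe_mul]
      ring
    have h1 : ∫ y, F (x * y) ∂μ = ∫ y, F y ∂μ := integral_mul_left_eq_self F x
    simp only [hmul] at h1
    rw [integral_const_mul] at h1
    have h2 : F x ≠ 1 := by
      intro h
      apply hx
      have h3 : (χ x)⁻¹ * char p d l x = 1 := by
        apply Circle.ext
        rw [Circle.coe_mul]
        exact h
      exact (inv_mul_eq_one.mp h3)
    have h3 : (F x - 1) * ∫ y, F y ∂μ = 0 := by rw [sub_mul, h1]; ring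
    exact (mul_eq_zero.mp h3).resolve_left (sub_ne_zero.mpr h2)
  have hs : ∀ g ∈ Submodule.span ℂ (Set.range fun q : ℕ × ℤ => toC (char p q.1 q.2)),
      ∫ y, (toC χ⁻¹ * g) y ∂μ = 0 := by
    intro g hg
    induction hg using Submodule.span_induction with
    | mem x hx => obtain ⟨⟨d, l⟩, rfl⟩ := hx; exact hzero d l
    | zero => simp
    | add x y _ _ hx hy =>
      simp only [mul_add, ContinuousMap.add_apply]
      rw [integral_add (integrable_C μ _) (integrable_C μ _), hx, hy, add_zero]
    | smul c x _ hx =>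
      simp only [mul_smul_comm, ContinuousMap.smul_apply, integral_smul, hx, smul_zero]
  obtain ⟨g, hg, hfg⟩ := exists_span_near (toC χ) one_half_pos
  have hone : ∀ y, (toC χ⁻¹ * toC χ) y = 1 := by
    intro y
    show (((χ y)⁻¹ : Circle) : ℂ) * ((χ y : Circle) : ℂ) = 1
    rw [← Circle.coe_mul]; simp
  have h1 : ∫ y, (toC χ⁻¹ * (toC χ - g)) y ∂μ = 1 := by
    simp only [mul_sub, ContinuousMap.sub_apply]
    rw [integral_sub (integrable_C μ _) (integrable_C μ _), hs g hg]
    simp [hone]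
  have h2 : ‖∫ y, (toC χ⁻¹ * (toC χ - g)) y ∂μ‖ ≤ 1 / 2 * μ.real Set.univ := by
    refine norm_integral_le_of_norm_le_const (ae_of_all _ fun y => ?_)
    rw [ContinuousMap.mul_apply, norm_mul, toC_apply, Circle.norm_coe, one_mul]
    exact (hfg y).le
  rw [h1] at h2
  norm_num at h2

/-- The quadratic form `ψ_b` on the character group of `S_p`, `ψ_b(χ_{d,ℓ}) = b ℓ² / p^{2d}`.
Every character is some `χ_{d,ℓ}`, and the value does not depend on the choice of `d` and `ℓ`:
see `psi_char`. -/
def psi (p : ℕ) (b : ℝ≥0) (χ : PontryaginDual (solenoid p)) : ℝ :=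
  b * ((exists_eq_char χ).choose_spec.choose : ℝ) ^ 2 / p ^ (2 * (exists_eq_char χ).choose)

theorem psi_char [Fact p.Prime] (b : ℝ≥0) (d : ℕ) (l : ℤ) :
    psi p b (char p d l) = b * (l : ℝ) ^ 2 / p ^ (2 * d) := by
  have h := freq_unique (exists_eq_char (char p d l)).choose_spec.choose_spec
  rw [psi, mul_div_assoc, mul_div_assoc, mul_comm 2, mul_comm 2, pow_mul, pow_mul, ← div_pow,
    ← div_pow, h]

/-- The defining property of the symmetric Gauss measure `γ_ψ`: its Fourier transform is
`χ ↦ exp (-ψ(χ) / 2)`. -/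
def IsGauss (ψ : PontryaginDual (solenoid p) → ℝ) (γ : ProbabilityMeasure (solenoid p)) : Prop :=
  ∀ χ : PontryaginDual (solenoid p),
    ∫ y, (χ y : ℂ) ∂(γ : Measure (solenoid p)) = (Real.exp (-ψ χ / 2) : ℂ)

theorem exists_isGauss (p : ℕ) [Fact p.Prime] (b : ℝ≥0) :
    ∃ γ : ProbabilityMeasure (solenoid p), IsGauss (psi p b) γ := by
  have hm : Measurable (flow p) := continuous_flow.measurable
  refine ⟨⟨(gaussianReal 0 b).map (flow p), Measure.isProbabilityMeasure_map hm.aemeasurable⟩,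
    fun χ => ?_⟩
  obtain ⟨d, l, rfl⟩ := exists_eq_char χ
  refine (integral_map hm.aemeasurable
    (toC (char p d l)).continuous.aestronglyMeasurable).trans ?_
  rw [psi_char]
  have h := charFun_gaussianReal (μ := 0) (v := b) (l / p ^ d : ℝ)
  rw [charFun_apply_real] at h
  simp only [toC_apply, char_flow, Circle.coe_exp]
  push_cast at h ⊢
  rw [h]
  congr 1
  ring

theorem existsUnique_isGauss (p : ℕ) [Fact p.Prime] (b : ℝ≥0) :
    ∃! γ : ProbabilityMeasure (solenoid p), IsGauss (psi p b) γ := by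
  obtain ⟨γ, hγ⟩ := exists_isGauss p b
  exact ⟨γ, hγ, fun γ' hγ' => Subtype.ext
    (measure_ext (γ' : Measure (solenoid p)) (γ : Measure (solenoid p)) fun d l => (hγ' (char p d l)).trans (hγ (char p d l)).symm)⟩

/-- The symmetric Gauss measure `γ_{ψ_b}` on `S_p`: the unique probability measure whose Fourier
transform is `χ ↦ exp (-ψ_b(χ) / 2)`. -/
def gauss (p : ℕ) [Fact p.Prime] (b : ℝ≥0) : ProbabilityMeasure (solenoid p) :=
  (existsUnique_isGauss p b).choose

theorem isGauss_gauss (p : ℕ) [Fact p.Prime] (b : ℝ≥0) : IsGauss (psi p b) (gauss p b) :=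
  (existsUnique_isGauss p b).choose_spec.1

end solenoid

/-- The argument on the circle with values in `[-π, π)` (Mathlib's `Complex.arg` takes values in
`(-π, π]`). -/
def circleArg (z : Circle) : ℝ :=
  if Complex.arg z = Real.pi then -Real.pi else Complex.arg z

theorem circleArg_exp {x : ℝ} (h₁ : -Real.pi ≤ x) (h₂ : x < Real.pi) :
    circleArg (Circle.exp x) = x := by
  rcases h₁.eq_or_lt with rfl | h
  · have h : Circle.exp (-Real.pi) = Circle.exp Real.pi := by
      rw [Circle.exp_eq_exp]; exact ⟨-1, by push_cast; ring⟩
    rw [circleArg, h, Circle.arg_exp (by linarith [Real.pi_pos]) le_rfl, if_pos rfl]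
  · rw [circleArg, Circle.arg_exp h h₂.le, if_neg h₂.ne]

/-- An array `X_{n,k}`, `1 ≤ k ≤ K_n`, of random elements of a topological group is infinitesimal
if `max_k P(X_{n,k} ∉ U) → 0` for every Borel neighbourhood `U` of the identity (the maximum over
an empty row is `0`). -/
def IsInfinitesimal {G : Type*} [Group G] [TopologicalSpace G] [MeasurableSpace G]
    {Ω : ℕ → Type*} [∀ n, MeasurableSpace (Ω n)] (P : ∀ n, Measure (Ω n)) (K : ℕ → ℕ)
    (X : ∀ n, Fin (K n) → Ω n → G) : Prop :=
  ∀ U : Set G, MeasurableSet U → U ∈ 𝓝 (1 : G) →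
    Tendsto (fun n => ⨆ k : Fin (K n), (P n).real {ω | X n k ω ∉ U}) atTop (𝓝 0)

end

/-! Near the identity the solenoid looks like the real line as far as any single character is
concerned. If `y 0, …, y d` all have small argument, then taking `p`-th powers never wraps around
the circle, so `arg (y 0) = p ^ d * arg (y d)` and `χ_{d,ℓ}(y) = exp (i t arg (y 0))` with `t = ℓ /
p ^ d` (`circleArg_zero_eq_pow_mul`). The tail condition makes the total probability of the
exceptional events in a row tend to `0`, so every character may be replaced by this exponential
(`norm_integral_char_sub_le`).

What remains is a central limit theorem for the bounded real array `θ = arg (X 0)`. Boundedness,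
convergent variances and vanishing tails give Lyapunov's third-moment condition. A Taylor comparison
with Gaussian factors then shows that the product of characteristic functions is asymptotic to `exp
(i t S) * exp (-t² V / 2)`, where `S` and `V` are the sums of means and variances
(`tendsto_prod_integral_exp_sub`). The sums `S` need not converge; only `exp (i S / p ^ d)` does,
and its `ℓ`-th power supplies the factor `a_d ^ ℓ`.

Finally, trigonometric polynomials are uniformly dense, so convergence of Fourier transforms gives
weak convergence (`tendsto_of_tendsto_integral_char`). Infinitesimality comes directly from the tail
condition, because a neighbourhood of the identity constrains only finitely many coordinates. -/

theorem circle_exp_circleArg (z : Circle) : Circle.exp (circleArg z) = z := by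
  unfold circleArg
  split_ifs with h
  · conv_rhs => rw [← Circle.exp_arg z]
    rw [Circle.exp_eq_exp]
    exact ⟨-1, by rw [h]; push_cast; ring⟩
  · exact Circle.exp_arg z

theorem abs_circleArg_le (z : Circle) : |circleArg z| ≤ Real.pi := by
  unfold circleArg
  split_ifs with h
  · rw [abs_neg, abs_of_pos Real.pi_pos]
  · exact Complex.abs_arg_le_pi _

theorem solenoid.measurable_circleArg_coord {p : ℕ} (j : ℕ) :
    Measurable fun y : solenoid p => circleArg (y.1 j) := by
  have h : Measurable fun y : solenoid p => Complex.arg (y.1 j) :=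
    Complex.measurable_arg.comp (continuous_subtype_val.comp
      ((continuous_apply j).comp continuous_subtype_val)).measurable
  exact Measurable.ite (h (measurableSet_singleton _)) measurable_const h

/-! ### Estimates for products and exponentials -/

/-- Exchange the factors one at a time: the others have norm at most `1`, so each exchange costs at
most `‖f i - g i‖`. This serves twice, to pass from characters to real exponentials and from those
to Gaussian factors. -/
theorem norm_prod_sub_prod_le_sum {ι : Type*} (s : Finset ι) (f g : ι → ℂ)
    (hf : ∀ i ∈ s, ‖f i‖ ≤ 1) (hg : ∀ i ∈ s, ‖g i‖ ≤ 1) :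
    ‖∏ i ∈ s, f i - ∏ i ∈ s, g i‖ ≤ ∑ i ∈ s, ‖f i - g i‖ := by
  classical
  induction s using Finset.induction_on with
  | empty => simp
  | insert i s hi ih =>
    rw [Finset.prod_insert hi, Finset.prod_insert hi, Finset.sum_insert hi]
    have hf' : ∀ j ∈ s, ‖f j‖ ≤ 1 := fun j hj => hf j (Finset.mem_insert_of_mem hj)
    have h1 : ‖∏ j ∈ s, f j‖ ≤ 1 := by
      rw [norm_prod]; exact Finset.prod_le_one (fun _ _ => norm_nonneg _) hf'
    have h2 := ih hf' fun j hj => hg j (Finset.mem_insert_of_mem hj)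
    calc ‖f i * ∏ j ∈ s, f j - g i * ∏ j ∈ s, g j‖
        = ‖(f i - g i) * ∏ j ∈ s, f j + g i * (∏ j ∈ s, f j - ∏ j ∈ s, g j)‖ := by
          congr 1; ring
      _ ≤ ‖f i - g i‖ * ‖∏ j ∈ s, f j‖ + ‖g i‖ * ‖∏ j ∈ s, f j - ∏ j ∈ s, g j‖ := by
          rw [← norm_mul, ← norm_mul]; exact norm_add_le _ _
      _ ≤ ‖f i - g i‖ * 1 + 1 * ∑ j ∈ s, ‖f j - g j‖ := by
          gcongr
          exact hg i (Finset.mem_insert_self i s)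
      _ = _ := by ring

theorem norm_exp_mul_I_sub_le {x B : ℝ} (h : |x| ≤ B) :
    ‖Complex.exp (x * Complex.I) - (1 + x * Complex.I - (x : ℂ) ^ 2 / 2)‖
      ≤ Real.exp B * |x| ^ 3 := by
  have h1 := Complex.norm_exp_sub_sum_le_norm_mul_exp (x * Complex.I) 3
  have h2 : ∑ m ∈ Finset.range 3, (x * Complex.I) ^ m / (m.factorial : ℂ)
      = 1 + x * Complex.I - (x : ℂ) ^ 2 / 2 := by
    simp [Finset.sum_range_succ, mul_pow, Nat.factorial]
    ring
  rw [h2] at h1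
  simp only [norm_mul, Complex.norm_I, mul_one, Complex.norm_real, Real.norm_eq_abs] at h1
  refine h1.trans ?_
  rw [mul_comm]
  gcongr

theorem abs_exp_neg_sub_le {x : ℝ} (hx : 0 ≤ x) :
    |Real.exp (-x) - (1 - x)| ≤ Real.exp x * x ^ 2 := by
  have h1 := Complex.norm_exp_sub_sum_le_norm_mul_exp ((-x : ℝ) : ℂ) 2
  have h2 : Complex.exp ((-x : ℝ) : ℂ)
        - ∑ m ∈ Finset.range 2, ((-x : ℝ) : ℂ) ^ m / (m.factorial : ℂ)
      = ((Real.exp (-x) - (1 - x) : ℝ) : ℂ) := by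
    simp [Finset.sum_range_succ, Nat.factorial]
    ring
  rw [h2, Complex.norm_real, Complex.norm_real, Real.norm_eq_abs, Real.norm_eq_abs, abs_neg,
    abs_of_nonneg hx] at h1
  linarith [mul_comm (x ^ 2) (Real.exp x)]

/-! ### Third-moment bounds for one bounded variable -/

section Centered

variable {Ω : Type*} [MeasurableSpace Ω] {P : Measure Ω} [IsProbabilityMeasure P]
  {Y : Ω → ℝ} {M : ℝ}

theorem integrable_pow_of_abs_le (hY : Measurable Y) (hM : ∀ ω, |Y ω| ≤ M) (n : ℕ) :
    Integrable (fun ω => |Y ω| ^ n) P := by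
  refine Integrable.of_bound (by fun_prop) (M ^ n) (ae_of_all _ fun ω => ?_)
  rw [Real.norm_eq_abs, abs_pow, abs_abs]
  exact pow_le_pow_left₀ (abs_nonneg _) (hM ω) n

/-- The variance of `Y²` is nonnegative, so `(E Y²)² ≤ E Y⁴`, and one factor of `Y⁴` is bounded by
`M`. This lets the third moment also control the error made on the Gaussian side, which is quadratic
in the variance. -/
theorem sq_integral_sq_le (hY : Measurable Y) (hM : ∀ ω, |Y ω| ≤ M) :
    (∫ ω, Y ω ^ 2 ∂P) ^ 2 ≤ M * ∫ ω, |Y ω| ^ 3 ∂P := by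
  have hint4 := integrable_pow_of_abs_le (P := P) hY hM 4
  have hint3 := integrable_pow_of_abs_le (P := P) hY hM 3
  have hm : MemLp (fun ω => Y ω ^ 2) 2 P := by
    refine MemLp.of_bound (by fun_prop) (M ^ 2) (ae_of_all _ fun ω => ?_)
    rw [Real.norm_eq_abs, abs_pow]
    exact pow_le_pow_left₀ (abs_nonneg _) (hM ω) 2
  have h1 := variance_nonneg (fun ω => Y ω ^ 2) P
  rw [variance_eq_sub hm] at h1
  have h2 : ∫ ω, ((fun ω => Y ω ^ 2) ^ 2) ω ∂P ≤ M * ∫ ω, |Y ω| ^ 3 ∂P := by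
    rw [← integral_const_mul]
    have he : ∀ ω, ((fun ω => Y ω ^ 2) ^ 2) ω = |Y ω| ^ 4 := fun ω => by
      simp only [Pi.pow_apply]
      rw [← pow_mul, Even.pow_abs (by decide)]
    simp only [he]
    refine integral_mono hint4 (hint3.const_mul M) fun ω => ?_
    have := mul_le_mul_of_nonneg_right (hM ω) (pow_nonneg (abs_nonneg (Y ω)) 3)
    simp only
    linarith [pow_succ' |Y ω| 3]
  linarith

/-- Third-order comparison of the characteristic function of a bounded centered variable with
that of the centered Gaussian of the same variance. -/
theorem norm_integral_exp_sub_exp_le (hY : Measurable Y) (hM : ∀ ω, |Y ω| ≤ M)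
    (h0 : ∫ ω, Y ω ∂P = 0) (t : ℝ) :
    ‖∫ ω, Complex.exp ((t * Y ω : ℝ) * Complex.I) ∂P
        - (Real.exp (-(t ^ 2 / 2 * ∫ ω, Y ω ^ 2 ∂P)) : ℂ)‖
      ≤ (Real.exp (|t| * M) * |t| ^ 3 + Real.exp (t ^ 2 / 2 * M ^ 2) * (t ^ 2 / 2) ^ 2 * M)
        * ∫ ω, |Y ω| ^ 3 ∂P := by
  set v := ∫ ω, Y ω ^ 2 ∂P with hv
  have hint3 := integrable_pow_of_abs_le (P := P) hY hM 3
  have hint2 : Integrable (fun ω => Y ω ^ 2) P := by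
    simpa only [sq_abs] using integrable_pow_of_abs_le (P := P) hY hM 2
  have hint1 : Integrable Y P :=
    Integrable.of_bound hY.aestronglyMeasurable M (ae_of_all _ hM)
  have hv0 : 0 ≤ v := integral_nonneg fun ω => sq_nonneg _
  have hvM : v ≤ M ^ 2 := by
    have : v ≤ ∫ _, M ^ 2 ∂P := integral_mono hint2 (integrable_const _) fun ω => by
      simp only [← sq_abs (Y ω)]
      exact pow_le_pow_left₀ (abs_nonneg _) (hM ω) 2
    simpa using this
  have hexp : Integrable (fun ω => Complex.exp ((t * Y ω : ℝ) * Complex.I)) P := by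
    refine Integrable.of_bound (by fun_prop) 1 (ae_of_all _ fun ω => ?_)
    rw [Complex.norm_exp_ofReal_mul_I]
  have hlin : Integrable (fun ω => ((t * Y ω : ℝ) : ℂ) * Complex.I) P :=
    ((hint1.const_mul t).ofReal).mul_const _
  have hquad : Integrable (fun ω => ((t * Y ω : ℝ) : ℂ) ^ 2 / 2) P := by
    have h := (hint2.const_mul (t ^ 2 / 2)).ofReal (𝕜 := ℂ)
    refine h.congr (ae_of_all _ fun ω => ?_)
    simp only [Complex.coe_algebraMap]
    push_cast; ring
  have hone : Integrable (fun _ : Ω => (1 : ℂ)) P := integrable_const _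
  have haff : Integrable (fun ω => 1 + ((t * Y ω : ℝ) : ℂ) * Complex.I) P := hone.add hlin
  have hint : Integrable
      (fun ω => 1 + ((t * Y ω : ℝ) : ℂ) * Complex.I - ((t * Y ω : ℝ) : ℂ) ^ 2 / 2) P :=
    haff.sub hquad
  -- Since `Y` is centered, the second-order Taylor polynomial integrates to `1 - t² v / 2`. Both
  -- the characteristic function (`hA`) and the Gaussian one (`hB`) are compared with this number.
  have hpoly : ∫ ω, (1 + ((t * Y ω : ℝ) : ℂ) * Complex.I - ((t * Y ω : ℝ) : ℂ) ^ 2 / 2) ∂P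
      = ((1 - t ^ 2 / 2 * v : ℝ) : ℂ) := by
    rw [integral_sub haff hquad, integral_add hone hlin, integral_mul_const,
      integral_complex_ofReal, integral_const_mul, h0]
    have : ∫ ω, ((t * Y ω : ℝ) : ℂ) ^ 2 / 2 ∂P = ((t ^ 2 / 2 * v : ℝ) : ℂ) := by
      rw [hv, ← integral_const_mul, ← integral_complex_ofReal]
      refine integral_congr_ae (ae_of_all _ fun ω => ?_)
      push_cast; ring
    rw [this]
    simp
  have hA : ‖∫ ω, Complex.exp ((t * Y ω : ℝ) * Complex.I) ∂P - ((1 - t ^ 2 / 2 * v : ℝ) : ℂ)‖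
      ≤ Real.exp (|t| * M) * |t| ^ 3 * ∫ ω, |Y ω| ^ 3 ∂P := by
    rw [← hpoly, ← integral_sub hexp hint, ← integral_const_mul]
    refine norm_integral_le_of_norm_le (hint3.const_mul _) (ae_of_all _ fun ω => ?_)
    refine (norm_exp_mul_I_sub_le (B := |t| * M) ?_).trans_eq ?_
    · rw [abs_mul]; exact mul_le_mul_of_nonneg_left (hM ω) (abs_nonneg t)
    · rw [abs_mul]; ring
  have hB : ‖((1 - t ^ 2 / 2 * v : ℝ) : ℂ) - (Real.exp (-(t ^ 2 / 2 * v)) : ℂ)‖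
      ≤ Real.exp (t ^ 2 / 2 * M ^ 2) * (t ^ 2 / 2) ^ 2 * M * ∫ ω, |Y ω| ^ 3 ∂P := by
    rw [← Complex.ofReal_sub, Complex.norm_real, norm_sub_rev, Real.norm_eq_abs]
    refine (abs_exp_neg_sub_le (by positivity)).trans ?_
    calc Real.exp (t ^ 2 / 2 * v) * (t ^ 2 / 2 * v) ^ 2
        = Real.exp (t ^ 2 / 2 * v) * (t ^ 2 / 2) ^ 2 * v ^ 2 := by ring
      _ ≤ Real.exp (t ^ 2 / 2 * M ^ 2) * (t ^ 2 / 2) ^ 2 * (M * ∫ ω, |Y ω| ^ 3 ∂P) := by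
          gcongr
          exact sq_integral_sq_le hY hM
      _ = _ := by ring
  rw [add_mul]
  exact (norm_sub_le_norm_sub_add_norm_sub _ _ _).trans (add_le_add hA hB)

end Centered

/-- Split at the event `ε < |θ|`. On it the cube is at most `(2B)³`. Off it the deviation from the
mean is at most `3ε`, and the other two factors make up the variance; this needs a small mean, which
`hsmall` ensures. -/
theorem integral_abs_sub_mean_cube_le {Ω : Type*} [MeasurableSpace Ω] {P : Measure Ω}
    [IsProbabilityMeasure P] {θ : Ω → ℝ} {B ε : ℝ} (hθ : Measurable θ) (hB : ∀ ω, |θ ω| ≤ B)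
    (hε : 0 ≤ ε) (hsmall : B * P.real {ω | ε < |θ ω|} ≤ ε) :
    ∫ ω, |θ ω - ∫ x, θ x ∂P| ^ 3 ∂P
      ≤ 3 * ε * variance θ P + (2 * B) ^ 3 * P.real {ω | ε < |θ ω|} := by
  set m := ∫ x, θ x ∂P with hm
  set A : Set Ω := {ω | ε < |θ ω|} with hA
  have hAm : MeasurableSet A := measurableSet_lt measurable_const hθ.abs
  have hind : Integrable (A.indicator (1 : Ω → ℝ)) P :=
    (integrable_const (1 : ℝ)).indicator hAm
  have hθi : Integrable θ P :=
    Integrable.of_bound hθ.aestronglyMeasurable B (ae_of_all _ hB)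
  have hmB : |m| ≤ B := by
    have := norm_integral_le_of_norm_le_const (μ := P) (f := θ) (C := B) (ae_of_all _ hB)
    simpa using this
  -- Integrate `|θ| ≤ ε + B · 1_A` and apply `hsmall` to the second term.
  have hm2 : |m| ≤ 2 * ε := by
    have h1 : |m| ≤ ∫ ω, (ε + B * A.indicator 1 ω) ∂P := by
      refine norm_integral_le_of_norm_le (f := θ) (g := fun ω => ε + B * A.indicator 1 ω)
        ((integrable_const ε).add (hind.const_mul B))
        (ae_of_all _ fun ω => ?_)
      rw [Real.norm_eq_abs]
      by_cases h : ω ∈ A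
      · simp only [Set.indicator_of_mem h, Pi.one_apply]; linarith [hB ω]
      · simp only [Set.indicator_of_notMem h]
        have : |θ ω| ≤ ε := not_lt.mp h
        linarith
    rw [integral_add (integrable_const ε) (hind.const_mul B), integral_const_mul,
      integral_indicator_one hAm] at h1
    simp at h1
    linarith
  have hdm : Measurable fun ω => θ ω - m := hθ.sub_const m
  have hd : ∀ ω, |θ ω - m| ≤ 2 * B := fun ω => by
    linarith [abs_sub (θ ω) m, hB ω]
  have hsq : Integrable (fun ω => (θ ω - m) ^ 2) P := by
    simpa only [sq_abs] using integrable_pow_of_abs_le (P := P) hdm hd 2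
  rw [variance_eq_integral hθ.aemeasurable, ← integral_indicator_one hAm, ← integral_const_mul,
    ← integral_const_mul, ← integral_add (hsq.const_mul _) (hind.const_mul _)]
  refine integral_mono (integrable_pow_of_abs_le hdm hd 3)
    ((hsq.const_mul _).add (hind.const_mul _)) fun ω => ?_
  simp only
  by_cases h : ω ∈ A
  · simp only [Set.indicator_of_mem h, Pi.one_apply, mul_one]
    have := pow_le_pow_left₀ (abs_nonneg _) (hd ω) 3
    have h2 : 0 ≤ 3 * ε * (θ ω - m) ^ 2 := by positivity
    linarith
  · simp only [Set.indicator_of_notMem h, mul_zero, add_zero]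
    have h1 : |θ ω| ≤ ε := not_lt.mp h
    have h2 : |θ ω - m| ≤ 3 * ε := by linarith [abs_sub (θ ω) m]
    calc |θ ω - m| ^ 3 = |θ ω - m| * (θ ω - m) ^ 2 := by rw [← sq_abs]; ring
      _ ≤ _ := by gcongr

/-! ### Central limit theorem for bounded real arrays -/

section Array

variable {Ω : ℕ → Type*} [∀ n, MeasurableSpace (Ω n)]
  {P : ∀ n, Measure (Ω n)} [∀ n, IsProbabilityMeasure (P n)]
  {K : ℕ → ℕ} {θ : ∀ n, Fin (K n) → Ω n → ℝ} {B b : ℝ}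

/-- A uniformly bounded, uniformly small array with bounded variance satisfies Lyapunov's
third-moment condition. -/
theorem tendsto_sum_integral_abs_sub_mean_cube (hθ : ∀ n k, Measurable (θ n k))
    (hB : ∀ n k ω, |θ n k ω| ≤ B) (hB0 : 0 ≤ B)
    (hvar : Tendsto (fun n => ∑ k, variance (θ n k) (P n)) atTop (𝓝 b))
    (htail : ∀ ε : ℝ, 0 < ε →
      Tendsto (fun n => ∑ k, (P n).real {ω | ε < |θ n k ω|}) atTop (𝓝 0)) :
    Tendsto (fun n => ∑ k, ∫ ω, |θ n k ω - ∫ x, θ n k x ∂(P n)| ^ 3 ∂(P n)) atTop (𝓝 0) := by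
  refine tendsto_order.2 ⟨fun c hc => Eventually.of_forall fun n => hc.trans_le
    (Finset.sum_nonneg fun k _ => integral_nonneg fun ω => by positivity), fun η hη => ?_⟩
  set c : ℝ := |b| + 1 with hc
  have hc0 : 0 < c := by positivity
  -- Chosen so that `3 * ε * c = η / 2`, where `c` is positive and exceeds the limit `b` of the
  -- variance sums.
  set ε : ℝ := η / (6 * c) with hεdef
  have hε : 0 < ε := by positivity
  have hv : ∀ᶠ n in atTop, ∑ k, variance (θ n k) (P n) < c :=
    hvar.eventually_lt_const (by linarith [le_abs_self b])
  have hq1 : ∀ᶠ n in atTop, B * ∑ k, (P n).real {ω | ε < |θ n k ω|} < ε := by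
    have := (htail ε hε).const_mul B
    rw [mul_zero] at this
    exact this.eventually_lt_const hε
  have hq2 : ∀ᶠ n in atTop, (2 * B) ^ 3 * ∑ k, (P n).real {ω | ε < |θ n k ω|} < η / 2 := by
    have := (htail ε hε).const_mul ((2 * B) ^ 3)
    rw [mul_zero] at this
    exact this.eventually_lt_const (by positivity)
  filter_upwards [hv, hq1, hq2] with n h1 h2 h3
  -- A bound on the whole row sum gives the smallness hypothesis for every `k` at once.
  have hk : ∀ k, B * (P n).real {ω | ε < |θ n k ω|} ≤ ε := fun k => by
    refine le_trans (mul_le_mul_of_nonneg_left ?_ hB0) h2.le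
    exact Finset.single_le_sum (f := fun k => (P n).real {ω | ε < |θ n k ω|})
      (fun _ _ => measureReal_nonneg) (Finset.mem_univ k)
  calc ∑ k, ∫ ω, |θ n k ω - ∫ x, θ n k x ∂(P n)| ^ 3 ∂(P n)
      ≤ ∑ k, (3 * ε * variance (θ n k) (P n) + (2 * B) ^ 3 * (P n).real {ω | ε < |θ n k ω|}) :=
        Finset.sum_le_sum fun k _ =>
          integral_abs_sub_mean_cube_le (hθ n k) (hB n k) hε.le (hk k)
    _ = 3 * ε * ∑ k, variance (θ n k) (P n)
          + (2 * B) ^ 3 * ∑ k, (P n).real {ω | ε < |θ n k ω|} := by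
        rw [Finset.sum_add_distrib, Finset.mul_sum, Finset.mul_sum]
    _ < 3 * ε * c + η / 2 := by gcongr
    _ = η := by rw [hεdef]; field_simp; ring

/-- The product of the characteristic functions of the rows is asymptotic to the characteristic
function of the Gaussian with the same mean and variance as the row sum. -/
theorem tendsto_prod_integral_exp_sub (hθ : ∀ n k, Measurable (θ n k))
    (hB : ∀ n k ω, |θ n k ω| ≤ B) (hB0 : 0 ≤ B)
    (hvar : Tendsto (fun n => ∑ k, variance (θ n k) (P n)) atTop (𝓝 b))
    (htail : ∀ ε : ℝ, 0 < ε →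
      Tendsto (fun n => ∑ k, (P n).real {ω | ε < |θ n k ω|}) atTop (𝓝 0)) (t : ℝ) :
    Tendsto (fun n => ∏ k, ∫ ω, Complex.exp ((t * θ n k ω : ℝ) * Complex.I) ∂(P n)
      - Complex.exp ((t * ∑ k, ∫ ω, θ n k ω ∂(P n) : ℝ) * Complex.I)
        * (Real.exp (-(t ^ 2 / 2 * ∑ k, variance (θ n k) (P n))) : ℂ)) atTop (𝓝 0) := by
  -- The constant of `norm_integral_exp_sub_exp_le` with `M = 2 * B`, which bounds the centered
  -- variables uniformly in `n` and `k`.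
  set C : ℝ := Real.exp (|t| * (2 * B)) * |t| ^ 3
    + Real.exp (t ^ 2 / 2 * (2 * B) ^ 2) * (t ^ 2 / 2) ^ 2 * (2 * B) with hC
  have h3 := (tendsto_sum_integral_abs_sub_mean_cube hθ hB hB0 hvar htail).const_mul C
  rw [mul_zero] at h3
  refine squeeze_zero_norm (fun n => ?_) h3
  have hprod : Complex.exp ((t * ∑ k, ∫ ω, θ n k ω ∂(P n) : ℝ) * Complex.I)
        * (Real.exp (-(t ^ 2 / 2 * ∑ k, variance (θ n k) (P n))) : ℂ)
      = ∏ k, (Complex.exp ((t * ∫ ω, θ n k ω ∂(P n) : ℝ) * Complex.I)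
        * (Real.exp (-(t ^ 2 / 2 * variance (θ n k) (P n))) : ℂ)) := by
    rw [Finset.prod_mul_distrib, ← Complex.exp_sum, ← Complex.ofReal_prod, ← Real.exp_sum,
      Finset.sum_neg_distrib, ← Finset.mul_sum, ← Finset.sum_mul, ← Complex.ofReal_sum,
      ← Finset.mul_sum]
  rw [hprod, Finset.mul_sum]
  refine (norm_prod_sub_prod_le_sum _ _ _ (fun k _ => ?_) fun k _ => ?_).trans
    (Finset.sum_le_sum fun k _ => ?_)
  · have := norm_integral_le_of_norm_le_const (μ := P n)
      (f := fun ω => Complex.exp ((t * θ n k ω : ℝ) * Complex.I)) (C := 1)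
      (ae_of_all _ fun ω => (Complex.norm_exp_ofReal_mul_I _).le)
    simpa using this
  · rw [norm_mul, Complex.norm_exp_ofReal_mul_I, one_mul, Complex.norm_real, Real.norm_eq_abs,
      Real.abs_exp, Real.exp_le_one_iff, neg_nonpos]
    exact mul_nonneg (by positivity) (variance_nonneg _ _)
  · set m := ∫ ω, θ n k ω ∂(P n) with hm
    have hθi : Integrable (θ n k) (P n) :=
      Integrable.of_bound (hθ n k).aestronglyMeasurable B (ae_of_all _ (hB n k))
    have hmB : |m| ≤ B := by
      have := norm_integral_le_of_norm_le_const (μ := P n) (f := θ n k) (C := B)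
        (ae_of_all _ (hB n k))
      simpa using this
    have key := norm_integral_exp_sub_exp_le (P := P n) (Y := fun ω => θ n k ω - m)
      (M := 2 * B) ((hθ n k).sub_const m)
      (fun ω => by linarith [abs_sub (θ n k ω) m, hB n k ω])
      (by rw [integral_sub hθi (integrable_const m)]; simp [hm]) t
    rw [← variance_eq_integral (hθ n k).aemeasurable] at key
    refine le_trans (le_of_eq ?_) key
    -- The mean contributes a factor of modulus `1`, common to both terms, so centering does not
    -- change the norm of the difference.
    have hshift : ∫ ω, Complex.exp ((t * θ n k ω : ℝ) * Complex.I) ∂(P n)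
        = Complex.exp ((t * m : ℝ) * Complex.I)
          * ∫ ω, Complex.exp ((t * (θ n k ω - m) : ℝ) * Complex.I) ∂(P n) := by
      rw [← integral_const_mul]
      refine integral_congr_ae (ae_of_all _ fun ω => ?_)
      simp only
      rw [← Complex.exp_add]
      congr 1
      push_cast; ring
    rw [hshift, ← mul_sub, norm_mul, Complex.norm_exp_ofReal_mul_I, one_mul]

end Array

/-! ### From characters of the solenoid to the real line -/

namespace solenoid

variable {p : ℕ}

/-- Lévy's continuity theorem with a given limit. On a compact group, uniform density of
trigonometric polynomials suffices and no tightness argument is needed: an `ε / 3` argument passes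
from them to all continuous functions. -/
theorem tendsto_of_tendsto_integral_char {μ : ℕ → ProbabilityMeasure (solenoid p)}
    {ν : ProbabilityMeasure (solenoid p)}
    (h : ∀ d l, Tendsto (fun n => ∫ y, (char p d l y : ℂ) ∂(μ n : Measure (solenoid p))) atTop
      (𝓝 (∫ y, (char p d l y : ℂ) ∂(ν : Measure (solenoid p))))) :
    Tendsto μ atTop (𝓝 ν) := by
  have hs : ∀ g ∈ Submodule.span ℂ (Set.range fun q : ℕ × ℤ => toC (char p q.1 q.2)),
      Tendsto (fun n => ∫ y, g y ∂(μ n : Measure (solenoid p))) atTop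
        (𝓝 (∫ y, g y ∂(ν : Measure (solenoid p)))) := by
    intro g hg
    induction hg using Submodule.span_induction with
    | mem x hx => obtain ⟨⟨d, l⟩, rfl⟩ := hx; exact h d l
    | zero => simp
    | add x y _ _ hx hy =>
      have he : ∀ κ : ProbabilityMeasure (solenoid p), ∫ z, (x + y) z ∂(κ : Measure (solenoid p))
          = ∫ z, x z ∂(κ : Measure (solenoid p)) + ∫ z, y z ∂(κ : Measure (solenoid p)) :=
        fun κ => integral_add (integrable_C _ x) (integrable_C _ y)
      simp only [he]
      exact hx.add hy
    | smul c x _ hx =>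
      simp only [ContinuousMap.smul_apply, integral_smul]
      exact hx.const_smul c
  rw [ProbabilityMeasure.tendsto_iff_forall_integral_rclike_tendsto ℂ]
  intro f
  rw [Metric.tendsto_atTop]
  intro ε hε
  obtain ⟨g, hg, hfg⟩ := exists_span_near f.toContinuousMap (show 0 < ε / 3 by positivity)
  have key : ∀ κ : ProbabilityMeasure (solenoid p),
      dist (∫ y, f y ∂(κ : Measure (solenoid p))) (∫ y, g y ∂(κ : Measure (solenoid p)))
        ≤ ε / 3 := by
    intro κ
    have hf : Integrable (fun y => f y) (κ : Measure (solenoid p)) :=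
      integrable_C _ f.toContinuousMap
    rw [dist_eq_norm, ← integral_sub hf (integrable_C _ g)]
    refine (norm_integral_le_of_norm_le_const (ae_of_all _ fun y => (hfg y).le)).trans ?_
    simp
  obtain ⟨N, hN⟩ := Metric.tendsto_atTop.mp (hs g hg) (ε / 3) (by positivity)
  refine ⟨N, fun n hn => ?_⟩
  have h1 := key (μ n)
  have h2 := key ν
  rw [dist_comm] at h2
  have h3 := dist_triangle4 (∫ y, f y ∂(μ n : Measure (solenoid p)))
    (∫ y, g y ∂(μ n : Measure (solenoid p))) (∫ y, g y ∂(ν : Measure (solenoid p)))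
    (∫ y, f y ∂(ν : Measure (solenoid p)))
  linarith [hN n hn]

/-- The relation `y_j = y_{j+1} ^ p` says that `arg y_j` and `p * arg y_{j+1}` agree modulo `2π`.
They differ by at most `(p + 1) * ε < 2π`, so they are equal; iterate over `j`. -/
theorem circleArg_zero_eq_pow_mul {y : solenoid p} {d : ℕ} {ε : ℝ}
    (hε : (p + 1) * ε < 2 * Real.pi) (hy : ∀ j ≤ d, |circleArg (y.1 j)| ≤ ε) :
    circleArg (y.1 0) = p ^ d * circleArg (y.1 d) := by
  induction d with
  | zero => simp
  | succ d ih =>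
    rw [ih fun j hj => hy j (hj.trans d.le_succ)]
    have h1 : Circle.exp (circleArg (y.1 d)) = Circle.exp (p * circleArg (y.1 (d + 1))) := by
      rw [← nsmul_eq_mul, Circle.exp_nsmul, circle_exp_circleArg, circle_exp_circleArg]
      exact y.2 d
    obtain ⟨m, hm⟩ := Circle.exp_eq_exp.mp h1
    have h2 : |(m : ℝ)| * (2 * Real.pi) < 1 * (2 * Real.pi) := by
      have h3 : (m : ℝ) * (2 * Real.pi) = circleArg (y.1 d) - p * circleArg (y.1 (d + 1)) := by
        linarith
      have h4 : |(m : ℝ)| * (2 * Real.pi) = |(m : ℝ) * (2 * Real.pi)| := by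
        rw [abs_mul, abs_of_pos Real.two_pi_pos]
      rw [h4, h3]
      refine lt_of_le_of_lt (abs_sub _ _) ?_
      rw [abs_mul, Nat.abs_cast]
      have h5 := hy d d.le_succ
      have h6 := mul_le_mul_of_nonneg_left (hy (d + 1) le_rfl) (Nat.cast_nonneg (α := ℝ) p)
      linarith
    have h3 := lt_of_mul_lt_mul_right h2 Real.two_pi_pos.le
    have h4 : m = 0 := by
      rw [← Int.abs_lt_one_iff]; exact_mod_cast h3
    rw [h4, Int.cast_zero, zero_mul, add_zero] at hm
    rw [hm]; ring

theorem char_eq_exp_circleArg_zero [Fact p.Prime] {y : solenoid p} {d : ℕ} {ε : ℝ} (l : ℤ)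
    (hε : (p + 1) * ε < 2 * Real.pi) (hy : ∀ j ≤ d, |circleArg (y.1 j)| ≤ ε) :
    (char p d l y : ℂ) = Complex.exp ((l / p ^ d * circleArg (y.1 0) : ℝ) * Complex.I) := by
  have hp : (p : ℝ) ≠ 0 := by exact_mod_cast (Fact.out : p.Prime).ne_zero
  rw [← Circle.coe_exp, char_apply, circleArg_zero_eq_pow_mul hε hy]
  conv_lhs => rw [← circle_exp_circleArg (y.1 d)]
  rw [← Circle.exp_zsmul, zsmul_eq_mul]
  congr 2
  field_simp

/-- A basic neighbourhood in the product topology restricts finitely many coordinates: `d` bounds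
their indices and `ε` is the least of the radii up to `d`. -/
theorem exists_forall_abs_circleArg_le_imp_mem {U : Set (solenoid p)}
    (hU : U ∈ 𝓝 (1 : solenoid p)) :
    ∃ (d : ℕ) (ε : ℝ), 0 < ε ∧ ∀ y : solenoid p, (∀ j ≤ d, |circleArg (y.1 j)| ≤ ε) → y ∈ U := by
  obtain ⟨V, hV, hVU⟩ := mem_nhds_subtype _ _ _ |>.mp hU
  rw [nhds_pi, Filter.mem_pi] at hV
  obtain ⟨I, hI, s, hs, hsV⟩ := hV
  have hball : ∀ j, ∃ ε > 0, ∀ x : ℝ, |x| ≤ ε → Circle.exp x ∈ s j := by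
    intro j
    have h0 : Circle.exp ⁻¹' s j ∈ 𝓝 (0 : ℝ) := by
      refine Circle.exp.continuous.continuousAt ?_
      rw [Circle.exp_zero]
      exact hs j
    obtain ⟨ε, hε, h⟩ := Metric.nhds_basis_closedBall.mem_iff.mp h0
    exact ⟨ε, hε, fun x hx => h (by simpa using hx)⟩
  choose δ hδ hmem using hball
  obtain ⟨d, hd⟩ := hI.bddAbove
  refine ⟨d, (Finset.range (d + 1)).inf' ⟨0, by simp⟩ δ,
    (Finset.lt_inf'_iff _).mpr fun j _ => hδ j, fun y hy => hVU (hsV fun j hj => ?_)⟩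
  rw [← circle_exp_circleArg (y.1 j)]
  exact hmem j _ ((hy j (hd hj)).trans
    (Finset.inf'_le _ (Finset.mem_range.mpr (Nat.lt_succ_of_le (hd hj)))))

theorem measurableSet_exists_lt_abs_circleArg (d : ℕ) (ε : ℝ) :
    MeasurableSet {y : solenoid p | ∃ j ≤ d, ε < |circleArg (y.1 j)|} := by
  have : {y : solenoid p | ∃ j ≤ d, ε < |circleArg (y.1 j)|}
      = ⋃ j ∈ Set.Iic d, {y | ε < |circleArg (y.1 j)|} := by
    ext y; simp
  rw [this]
  exact MeasurableSet.biUnion (Set.to_countable _) fun j _ =>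
    measurableSet_lt measurable_const (measurable_circleArg_coord j).abs

/-- The integrands coincide off the exceptional event, and on it two numbers of modulus `1` differ
by at most `2`. -/
theorem norm_integral_char_sub_le [Fact p.Prime] {Ω : Type*} [MeasurableSpace Ω] {P : Measure Ω}
    [IsProbabilityMeasure P] {X : Ω → solenoid p} (hX : Measurable X) (d : ℕ) (l : ℤ) {ε : ℝ}
    (hε : (p + 1) * ε < 2 * Real.pi) :
    ‖∫ ω, (char p d l (X ω) : ℂ) ∂P
        - ∫ ω, Complex.exp ((l / p ^ d * circleArg ((X ω).1 0) : ℝ) * Complex.I) ∂P‖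
      ≤ 2 * P.real {ω | ∃ j ≤ d, ε < |circleArg ((X ω).1 j)|} := by
  set A : Set Ω := {ω | ∃ j ≤ d, ε < |circleArg ((X ω).1 j)|} with hA
  have hAm : MeasurableSet A := hX (measurableSet_exists_lt_abs_circleArg d ε)
  have hind : Integrable (A.indicator (1 : Ω → ℝ)) P :=
    (integrable_const (1 : ℝ)).indicator hAm
  have hm : Measurable fun ω => circleArg ((X ω).1 0) := (measurable_circleArg_coord 0).comp hX
  have h1 : Integrable (fun ω => (char p d l (X ω) : ℂ)) P :=
    Integrable.of_bound
      ((toC (char p d l)).continuous.measurable.comp hX).aestronglyMeasurable 1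
      (ae_of_all _ fun ω => (Circle.norm_coe _).le)
  have h2 : Integrable
      (fun ω => Complex.exp ((l / p ^ d * circleArg ((X ω).1 0) : ℝ) * Complex.I)) P :=
    Integrable.of_bound (Complex.measurable_exp.comp
      ((Complex.measurable_ofReal.comp (hm.const_mul _)).mul_const _)).aestronglyMeasurable 1
      (ae_of_all _ fun ω => (Complex.norm_exp_ofReal_mul_I _).le)
  rw [← integral_sub h1 h2, ← integral_indicator_one hAm, ← integral_const_mul]
  refine norm_integral_le_of_norm_le (hind.const_mul 2) (ae_of_all _ fun ω => ?_)
  by_cases h : ω ∈ A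
  · simp only [Set.indicator_of_mem h, Pi.one_apply, mul_one]
    refine (norm_sub_le _ _).trans_eq ?_
    rw [Circle.norm_coe, Complex.norm_exp_ofReal_mul_I]
    norm_num
  · have h3 : ∀ j ≤ d, |circleArg ((X ω).1 j)| ≤ ε := fun j hj =>
      not_lt.mp fun h4 => h ⟨j, hj, h4⟩
    rw [char_eq_exp_circleArg_zero l hε h3]
    simp [Set.indicator_of_notMem h]

theorem integral_char_dirac_mconv_gauss [Fact p.Prime] (a : solenoid p) (b : ℝ≥0) (d : ℕ)
    (l : ℤ) :
    ∫ y, (char p d l y : ℂ) ∂(Measure.dirac a ∗ₘ (gauss p b : Measure (solenoid p)))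
      = (a.1 d : ℂ) ^ l * (Real.exp (-((l / p ^ d : ℝ) ^ 2 / 2 * b)) : ℂ) := by
  refine (integral_mconv (integrable_C _ (toC (char p d l)))).trans ?_
  rw [integral_dirac]
  simp only [toC_apply, map_mul, Circle.coe_mul]
  rw [integral_const_mul, isGauss_gauss p b (char p d l), psi_char, char_apply, Circle.coe_zpow]
  congr 3
  ring

end solenoid

/-! ### The limit theorem -/

theorem mainTheorem11 (p : ℕ) [Fact p.Prime]
    {Ω : ℕ → Type*} [∀ n, MeasurableSpace (Ω n)]
    (P : ∀ n, Measure (Ω n)) [∀ n, IsProbabilityMeasure (P n)]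
    (K : ℕ → ℕ) (X : ∀ n, Fin (K n) → Ω n → solenoid p)
    (hmeas : ∀ n k, Measurable (X n k))
    (hindep : ∀ n, iIndepFun (X n) (P n))
    (a : solenoid p) (b : ℝ≥0)
    (hmean : ∀ d : ℕ, Tendsto
      (fun n => Complex.exp
        (Complex.I / (p : ℂ) ^ d * ((∑ k, ∫ ω, circleArg ((X n k ω).1 0) ∂(P n) : ℝ) : ℂ)))
      atTop (𝓝 (a.1 d : ℂ)))
    (hvar : Tendsto (fun n => ∑ k, variance (fun ω => circleArg ((X n k ω).1 0)) (P n))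
      atTop (𝓝 (b : ℝ)))
    (htail : ∀ (d : ℕ) (ε : ℝ), 0 < ε → Tendsto
      (fun n => ∑ k, (P n).real {ω | ∃ j ≤ d, ε < |circleArg ((X n k ω).1 j)|})
      atTop (𝓝 0)) :
    IsInfinitesimal P K X ∧
      TendstoInDistribution (fun n ω => ∏ k, X n k ω) atTop id P
        (Measure.dirac a ∗ₘ (solenoid.gauss p b : Measure (solenoid p))) := by
  constructor
  · intro U _ hU
    obtain ⟨d, ε, hε, hmem⟩ := solenoid.exists_forall_abs_circleArg_le_imp_mem hU
    refine squeeze_zero (fun n => Real.iSup_nonneg fun k => measureReal_nonneg) (fun n => ?_)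
      (htail d ε hε)
    -- The maximum is bounded by the sum; nonnegativity of the sum covers empty rows, where the
    -- supremum is `0`.
    refine Real.iSup_le (fun k => ?_) (Finset.sum_nonneg fun _ _ => measureReal_nonneg)
    have h1 : (P n).real {ω | X n k ω ∉ U}
        ≤ (P n).real {ω | ∃ j ≤ d, ε < |circleArg ((X n k ω).1 j)|} := by
      refine measureReal_mono fun ω hω => ?_
      by_contra h
      refine hω (hmem _ fun j hj => not_lt.mp fun h4 => h ⟨j, hj, h4⟩)
    exact h1.trans (Finset.single_le_sum
      (f := fun k => (P n).real {ω | ∃ j ≤ d, ε < |circleArg ((X n k ω).1 j)|})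
      (fun _ _ => measureReal_nonneg) (Finset.mem_univ k))
  · have hprodm : ∀ n, Measurable fun ω => ∏ k, X n k ω := fun n =>
      Finset.measurable_fun_prod _ fun k _ => hmeas n k
    refine ⟨fun n => (hprodm n).aemeasurable, aemeasurable_id,
      solenoid.tendsto_of_tendsto_integral_char fun d l => ?_⟩
    set t : ℝ := l / p ^ d with ht
    -- Rowwise independence enters here: a character is multiplicative, so the Fourier transform of
    -- the row product factors.
    have hleft : ∀ n, ∫ y, (solenoid.char p d l y : ℂ) ∂((P n).map fun ω => ∏ k, X n k ω)
        = ∏ k, ∫ ω, (solenoid.char p d l (X n k ω) : ℂ) ∂(P n) := fun n => by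
      have hc := (solenoid.toC (solenoid.char p d l)).continuous
      refine (integral_map (hprodm n).aemeasurable hc.aestronglyMeasurable).trans ?_
      rw [← (hindep n).integral_fun_prod_comp (f := fun _ y => (solenoid.char p d l y : ℂ))
        (fun k => (hmeas n k).aemeasurable) fun k => hc.aestronglyMeasurable]
      refine integral_congr_ae (ae_of_all _ fun ω => ?_)
      simp only [solenoid.toC_apply, map_prod]
      exact map_prod Circle.coeHom _ _
    have hgoal : Tendsto (fun n => ∏ k, ∫ ω, (solenoid.char p d l (X n k ω) : ℂ) ∂(P n)) atTop
        (𝓝 ((a.1 d : ℂ) ^ l * (Real.exp (-(t ^ 2 / 2 * b)) : ℂ))) := by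
      have hmean' : Tendsto (fun n => Complex.exp
          ((t * ∑ k, ∫ ω, circleArg ((X n k ω).1 0) ∂(P n) : ℝ) * Complex.I)) atTop
          (𝓝 ((a.1 d : ℂ) ^ l)) := by
        -- The `l`-th power turns `exp (i S / p ^ d)` into `exp (i t S)`; for negative `l`
        -- continuity of the power requires the limit `a_d` to be nonzero.
        refine ((hmean d).zpow₀ l (Or.inl (Circle.coe_ne_zero _))).congr fun n => ?_
        rw [← Complex.exp_int_mul]
        congr 1
        rw [ht]; push_cast; ring
      have hgauss := hmean'.mul
        ((Complex.continuous_ofReal.comp (Real.continuous_exp.comp continuous_neg)).tendsto _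
          |>.comp (hvar.const_mul (t ^ 2 / 2)))
      have hclt := tendsto_prod_integral_exp_sub (P := P)
        (θ := fun n k ω => circleArg ((X n k ω).1 0)) (B := Real.pi)
        (fun n k => (solenoid.measurable_circleArg_coord 0).comp (hmeas n k))
        (fun n k ω => abs_circleArg_le _) Real.pi_pos.le hvar
        (fun ε hε => by simpa using htail 0 ε hε) t
      -- The threshold `ε = 1 / (p + 1)` excludes wrapping, since then `(p + 1) * ε = 1`. A single
      -- fixed `ε` is enough for this replacement.
      have hε : ((p : ℝ) + 1) * (1 / (p + 1)) < 2 * Real.pi := by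
        rw [mul_one_div_cancel (by positivity)]
        linarith [Real.pi_gt_three]
      have hdiff : Tendsto (fun n => ∏ k, ∫ ω, (solenoid.char p d l (X n k ω) : ℂ) ∂(P n)
          - ∏ k, ∫ ω, Complex.exp ((t * circleArg ((X n k ω).1 0) : ℝ) * Complex.I) ∂(P n))
          atTop (𝓝 0) := by
        have h2 := (htail d (1 / (p + 1)) (by positivity)).const_mul 2
        rw [mul_zero] at h2
        refine squeeze_zero_norm (fun n => ?_) h2
        rw [Finset.mul_sum]
        refine (norm_prod_sub_prod_le_sum _ _ _ (fun k _ => ?_) fun k _ => ?_).trans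
          (Finset.sum_le_sum fun k _ =>
            solenoid.norm_integral_char_sub_le (hmeas n k) d l hε)
        · have := norm_integral_le_of_norm_le_const (μ := P n)
            (f := fun ω => (solenoid.char p d l (X n k ω) : ℂ)) (C := 1)
            (ae_of_all _ fun ω => (Circle.norm_coe _).le)
          simpa using this
        · have := norm_integral_le_of_norm_le_const (μ := P n)
            (f := fun ω => Complex.exp ((t * circleArg ((X n k ω).1 0) : ℝ) * Complex.I))
            (C := 1) (ae_of_all _ fun ω => (Complex.norm_exp_ofReal_mul_I _).le)
          simpa using this
      -- The three limits telescope: characters minus exponentials, exponentials minus the Gaussian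
      -- expression, and the Gaussian expression itself.
      have := (hdiff.add hclt).add hgauss
      rw [zero_add, zero_add] at this
      refine this.congr fun n => ?_
      simp only [Function.comp_apply]
      ring
    have hright := solenoid.integral_char_dirac_mconv_gauss a b d l
    simp only [ProbabilityMeasure.coe_mk, Measure.map_id]
    rw [hright]
    exact hgoal.congr fun n => (hleft n).symm
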